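/- Let $(\rho,V)$ be a finite-dimensional irreducible algebraic (i.e. rational) representation of $\mathrm{GL}_3(\mathbb C)$ with highest weight $\lambda=(\lambda_1\ge\lambda_2\ge\lambda_3)$, $\lambda_i\in\mathbb Z$, with respect to the diagonal torus $T$ and the Borel subgroup of upper triangular matrices, and suppose that its central character is trivial, i.e. $\lambda_1+\lambda_2+\lambda_3=0$. Let $V_0=\{v\in V:\rho(t)v=v\text{ for all }t\in T\}$ be its zero weight space. Then 1. $\dim V_0=\lambda_1-\lambda_2+1$ if $\lambda_2\ge 0$, and 2. $\dim V_0=\lambda_2-\lambda_3+1$ if $\lambda_2\le 0$. -/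

import Mathlib

open Matrix

namespace GLRep

variable {n : ℕ} {V : Type*} [AddCommGroup V] [Module ℂ V]

/-- A representation `ρ` of `GL_n(ℂ)` is algebraic (rational) if all its matrix coefficients
`g ↦ φ (ρ(g) v)` are regular functions on `GL_n`, that is, of the form `P(g_ij) / det(g) ^ k`
with `P` a polynomial in the matrix entries and `k` a natural number. -/
def IsAlgebraic (ρ : Representation ℂ (GL (Fin n) ℂ) V) : Prop :=
  ∀ (φ : Module.Dual ℂ V) (v : V), ∃ (P : MvPolynomial (Fin n × Fin n) ℂ) (k : ℕ),
    ∀ g : GL (Fin n) ℂ,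
      φ (ρ g v) =
        MvPolynomial.eval (fun ij : Fin n × Fin n => (g : Matrix (Fin n) (Fin n) ℂ) ij.1 ij.2) P /
          (g : Matrix (Fin n) (Fin n) ℂ).det ^ k

/-- The diagonal element `diag(t_1, …, t_n)` of the standard maximal torus `T` of `GL_n(ℂ)`. -/
noncomputable def torus : (Fin n → ℂˣ) →* GL (Fin n) ℂ where
  toFun t :=
    { val := Matrix.diagonal fun i => (t i : ℂ)
      inv := Matrix.diagonal fun i => ((t i)⁻¹ : ℂ)
      val_inv := by simp [Matrix.diagonal_mul_diagonal]
      inv_val := by simp [Matrix.diagonal_mul_diagonal] }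
  map_one' := by ext i j; simp
  map_mul' s t := by ext i j; simp [← Matrix.diagonal_mul_diagonal, Matrix.mul_diagonal]

/-- The `μ`-weight space of `T`: the vectors on which every `diag(t_1, …, t_n)` acts by the
scalar `t_1 ^ μ_1 ⋯ t_n ^ μ_n`. -/
def weightSpace (ρ : Representation ℂ (GL (Fin n) ℂ) V) (μ : Fin n → ℤ) : Submodule ℂ V where
  carrier := {v | ∀ t : Fin n → ℂˣ, ρ (torus t) v = (∏ i, (t i : ℂ) ^ μ i) • v}
  zero_mem' t := by simp
  add_mem' hv hw t := by rw [map_add, hv t, hw t, smul_add]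
  smul_mem' c v hv t := by rw [map_smul, hv t, smul_comm]

/-- The upper triangular matrices with all diagonal entries `1`: the unipotent radical of the
Borel subgroup of upper triangular matrices. -/
def IsUpperUnipotent (u : GL (Fin n) ℂ) : Prop :=
  (∀ i, (u : Matrix (Fin n) (Fin n) ℂ) i i = 1) ∧
    (u : Matrix (Fin n) (Fin n) ℂ).IsUpperTriangular

/-- `lam` is a highest weight of `ρ` (with respect to the upper triangular Borel subgroup): there
is a nonzero vector of weight `lam` fixed by all upper triangular unipotent matrices. -/
def HasHighestWeight (ρ : Representation ℂ (GL (Fin n) ℂ) V) (lam : Fin n → ℤ) : Prop :=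
  ∃ v ∈ weightSpace ρ lam, v ≠ 0 ∧ ∀ u : GL (Fin n) ℂ, IsUpperUnipotent u → ρ u v = v

/-- The zero weight space of `ρ`. -/
def zeroWeightSpace (ρ : Representation ℂ (GL (Fin n) ℂ) V) : Submodule ℂ V :=
  weightSpace ρ 0

end GLRep

/-! Put `p = λ₁ - λ₂`, `q = λ₂ - λ₃`, `m = min p q`; the claim is `dim V₀ = m + 1`. A highest weight
vector `v` and a suitable functional `φ` have the coefficient `φ (ρ g v) = g₁₁ ^ p * Δ₂(g) ^ q / det
g ^ r`, with `Δ₂` the upper left `2 × 2` minor and `r = -λ₃` (`exists_dual_apply_eq_minors`).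
Inserting the projection `P` onto `V₀` between `ρ g` and `ρ h` means taking a constant term in the
torus variables. By the multinomial theorem the kernel `φ (ρ g (P (ρ h v)))` is, up to a factor in
`g` and a factor in `h`, the sum `∑ c_γ ∏ (A_i B_i) ^ γ_i` over `|γ| = m`, with all `c_γ > 0`; here
`A` is the entrywise product of the first row of `g` with the cross product of its first two rows,
so `∑ A_i = 0`, and `B` is the same for `hᵀ`.

By irreducibility the vectors `P (ρ h v)` span `V₀` and the functionals `φ ∘ ρ g` separate its
points. The relation `∑ A_i = 0` leaves `m + 1` monomials, whence the upper bound
(`finrank_le_of_kernel`). Positivity of the `c_γ` makes the Gram matrix at `m + 1` real points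
nondegenerate, whence the lower bound (`le_finrank_of_kernel`). -/

/-- The coefficient functional of a character on the space of all functions. -/
theorem exists_character_coeff {M : Type*} [Monoid M] (χ : M →* ℂ) :
    ∃ L : (M → ℂ) →ₗ[ℂ] ℂ, L χ = 1 ∧ ∀ χ' : M →* ℂ, χ' ≠ χ → L χ' = 0 := by
  have li := linearIndependent_monoidHom M ℂ
  obtain ⟨L, hL⟩ := LinearMap.exists_extend ((Finsupp.lapply χ).comp li.repr)
  have key (χ' : M →* ℂ) : L χ' = Finsupp.single χ' (1 : ℂ) χ := by
    have h := LinearMap.congr_fun hL ⟨χ', Submodule.subset_span ⟨χ', rfl⟩⟩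
    rw [LinearMap.comp_apply, LinearMap.comp_apply] at h
    refine h.trans ?_
    rw [li.repr_eq_single χ' _ rfl, Finsupp.lapply_apply]
  exact ⟨L, by simp [key], fun χ' h => by simp [key, h]⟩

/-! ### Torus characters, weight projections and irreducibility. -/

namespace GLRep

/-- The character `t ↦ ∏ t_i ^ μ_i` of the diagonal torus. -/
noncomputable def torusChar {n : ℕ} (μ : Fin n → ℤ) : (Fin n → ℂˣ) →* ℂ where
  toFun t := ∏ i, (t i : ℂ) ^ μ i
  map_one' := by simp
  map_mul' s t := by simp [mul_zpow, Finset.prod_mul_distrib]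

theorem torusChar_apply {n : ℕ} (μ : Fin n → ℤ) (t : Fin n → ℂˣ) :
    torusChar μ t = ∏ i, (t i : ℂ) ^ μ i := rfl

/-- The character `s ↦ s ^ k` of the multiplicative group. -/
noncomputable def unitsChar (k : ℤ) : ℂˣ →* ℂ where
  toFun s := (s : ℂ) ^ k
  map_one' := by simp
  map_mul' s t := by simp [mul_zpow]

theorem unitsChar_apply (k : ℤ) (s : ℂˣ) : unitsChar k s = (s : ℂ) ^ k := rfl

theorem unitsChar_injective : Function.Injective unitsChar := by
  intro k l h
  have h2 := DFunLike.congr_fun h (Units.mk0 (2 : ℂ) two_ne_zero)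
  simp only [unitsChar_apply, Units.val_mk0] at h2
  have h3 : (2 : ℝ) ^ k = 2 ^ l := Complex.ofReal_injective (by push_cast; exact h2)
  exact zpow_right_injective₀ (by norm_num) (by norm_num) h3

theorem torusChar_injective {n : ℕ} : Function.Injective (torusChar (n := n)) := by
  classical
  intro μ ν h
  funext i
  apply unitsChar_injective
  ext s
  have h2 := DFunLike.congr_fun h (Function.update (1 : Fin n → ℂˣ) i s)
  have aux (κ : Fin n → ℤ) : torusChar κ (Function.update (1 : Fin n → ℂˣ) i s) = (s : ℂ) ^ κ i := by
    rw [torusChar_apply, Finset.prod_eq_single i]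
    · simp
    · intro j _ hj; simp [Function.update_of_ne hj]
    · simp
  rwa [aux, aux] at h2

theorem coe_torus {n : ℕ} (t : Fin n → ℂˣ) :
    (torus t : Matrix (Fin n) (Fin n) ℂ) = Matrix.diagonal fun i => (t i : ℂ) := rfl

variable {n : ℕ} {V : Type*} [AddCommGroup V] [Module ℂ V]

/-- On the torus each matrix entry is a character or zero, and so is a character `det ^ (-k)`.
Characters are closed under products, so their span is already an algebra. -/
theorem matrixCoeff_torus_mem_span {ρ : Representation ℂ (GL (Fin n) ℂ) V} (h : IsAlgebraic ρ)
    (φ : Module.Dual ℂ V) (v : V) :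
    (fun t => φ (ρ (torus t) v)) ∈
      Submodule.span ℂ (Set.range fun χ : (Fin n → ℂˣ) →* ℂ => (χ : (Fin n → ℂˣ) → ℂ)) := by
  set R := Set.range fun χ : (Fin n → ℂˣ) →* ℂ => (χ : (Fin n → ℂˣ) → ℂ)
  have hcl : (Submonoid.closure R : Set ((Fin n → ℂˣ) → ℂ)) ⊆ Submodule.span ℂ R := by
    have : Submonoid.closure R = MonoidHom.mrange (MonoidHom.coeFn (Fin n → ℂˣ) ℂ) :=
      Submonoid.closure_eq (MonoidHom.mrange (MonoidHom.coeFn (Fin n → ℂˣ) ℂ))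
    rw [this]
    exact Submodule.subset_span
  rw [← Algebra.adjoin_eq_span_of_subset ℂ hcl, Subalgebra.mem_toSubmodule]
  obtain ⟨P, k, hP⟩ := h φ v
  have hchar (μ : Fin n → ℤ) : (torusChar μ : (Fin n → ℂˣ) → ℂ) ∈ Algebra.adjoin ℂ R :=
    Algebra.subset_adjoin ⟨_, rfl⟩
  have hpoly : (fun t : Fin n → ℂˣ => MvPolynomial.eval (fun ij : Fin n × Fin n =>
      Matrix.diagonal (fun i => (t i : ℂ)) ij.1 ij.2) P) ∈ Algebra.adjoin ℂ R := by
    clear hP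
    induction P using MvPolynomial.induction_on with
    | C a =>
      simp only [MvPolynomial.eval_C]
      exact Subalgebra.algebraMap_mem _ a
    | add p q hp hq =>
      simp only [map_add]
      exact add_mem hp hq
    | mul_X p ij hp =>
      simp only [map_mul, MvPolynomial.eval_X]
      refine mul_mem hp ?_
      by_cases hij : ij.1 = ij.2
      · convert hchar (Pi.single ij.1 1) using 1
        funext t
        rw [hij, diagonal_apply_eq, torusChar_apply, Finset.prod_eq_single ij.2]
        · simp
        · intro j _ hj; simp [hj]
        · simp
      · convert zero_mem (Algebra.adjoin ℂ R) using 1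
        funext t
        exact diagonal_apply_ne _ hij
  convert mul_mem hpoly (hchar fun _ => -(k : ℤ)) using 1
  funext t
  rw [hP, coe_torus, det_diagonal, Pi.mul_apply, torusChar_apply, div_eq_mul_inv]
  simp [Finset.prod_pow]

/-- The projection to a weight space, computed by taking coefficients of characters. -/
theorem exists_weight_projection [FiniteDimensional ℂ V]
    {ρ : Representation ℂ (GL (Fin n) ℂ) V} (h : IsAlgebraic ρ) (μ : Fin n → ℤ)
    (L : ((Fin n → ℂˣ) → ℂ) →ₗ[ℂ] ℂ) (hL : L (torusChar μ) = 1)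
    (hL' : ∀ χ : (Fin n → ℂˣ) →* ℂ, χ ≠ torusChar μ → L χ = 0) :
    ∃ P : V →ₗ[ℂ] V, (∀ u, P u ∈ weightSpace ρ μ) ∧ (∀ u ∈ weightSpace ρ μ, P u = u) ∧
      ∀ (φ : Module.Dual ℂ V) (u : V), φ (P u) = L fun t => φ (ρ (torus t) u) := by
  let D : V →ₗ[ℂ] Module.Dual ℂ (Module.Dual ℂ V) :=
    LinearMap.mk₂ ℂ (fun u φ => L fun t => φ (ρ (torus t) u))
      (fun u u' φ => by rw [← map_add]; congr 1; funext t; simp)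
      (fun c u φ => by rw [← map_smul]; congr 1; funext t; simp)
      (fun u φ φ' => by rw [← map_add]; congr 1)
      (fun c u φ => by rw [← map_smul]; congr 1)
  have hP (φ : Module.Dual ℂ V) (u : V) :
      φ ((Module.evalEquiv ℂ V).symm (D u)) = L fun t => φ (ρ (torus t) u) := by
    rw [Module.apply_evalEquiv_symm_apply]
    rfl
  refine ⟨(Module.evalEquiv ℂ V).symm.toLinearMap ∘ₗ D, fun u s => ?_, fun u hu => ?_, hP⟩
  · refine (Module.evalEquiv ℂ V).injective (LinearMap.ext fun φ => ?_)
    change φ _ = φ _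
    rw [map_smul, LinearMap.comp_apply, LinearEquiv.coe_coe, hP]
    rw [← LinearMap.comp_apply, hP]
    -- On combinations of characters `L` sees only the `μ` term, which translation by `s` scales by
    -- its value at `s`.
    have key (f : (Fin n → ℂˣ) → ℂ) (hf : f ∈ Submodule.span ℂ
        (Set.range fun χ : (Fin n → ℂˣ) →* ℂ => (χ : (Fin n → ℂˣ) → ℂ))) :
        (L fun t => f (s * t)) = torusChar μ s • L f := by
      induction hf using Submodule.span_induction with
      | mem f hf =>
        obtain ⟨χ, rfl⟩ := hf
        have : (fun t => χ (s * t)) = χ s • (χ : (Fin n → ℂˣ) → ℂ) := by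
          funext t; simp
        rw [this, map_smul]
        by_cases hχ : χ = torusChar μ
        · rw [hχ]
        · simp [hL' χ hχ]
      | zero => exact (map_zero L).trans (by simp)
      | add f g _ _ hf hg =>
        rw [map_add, smul_add, ← hf, ← hg, ← map_add]; rfl
      | smul c f _ hf =>
        rw [map_smul, smul_comm, ← hf, ← map_smul]; rfl
    rw [← torusChar_apply, ← key _ (matrixCoeff_torus_mem_span h φ u)]
    congr 1
    funext t
    rw [map_mul, map_mul]; rfl
  · refine (Module.evalEquiv ℂ V).injective (LinearMap.ext fun φ => ?_)
    change φ _ = φ _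
    rw [LinearMap.comp_apply, LinearEquiv.coe_coe, hP]
    have : (fun t => φ (ρ (torus t) u)) = φ u • (torusChar μ : (Fin n → ℂˣ) → ℂ) := by
      funext t
      rw [hu t, map_smul, Pi.smul_apply, torusChar_apply, smul_eq_mul, smul_eq_mul, mul_comm]
    rw [this, map_smul, hL, smul_eq_mul, mul_one]

/-- In an irreducible representation, the translates of a nonzero vector span. -/
theorem span_orbit_eq_top {ρ : Representation ℂ (GL (Fin n) ℂ) V} (hirr : ρ.IsIrreducible)
    {v : V} (hv : v ≠ 0) : Submodule.span ℂ (Set.range fun g => ρ g v) = ⊤ := by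
  let S : Subrepresentation ρ :=
    { toSubmodule := Submodule.span ℂ (Set.range fun g => ρ g v)
      apply_mem_toSubmodule := fun g w hw => by
        induction hw using Submodule.span_induction with
        | mem w hw =>
          obtain ⟨h, rfl⟩ := hw
          exact Submodule.subset_span ⟨g * h, by simp⟩
        | zero => simp
        | add x y _ _ hx hy => rw [map_add]; exact add_mem hx hy
        | smul c x _ hx => rw [map_smul]; exact Submodule.smul_mem _ _ hx }
  rcases hirr.eq_bot_or_eq_top S with h | h
  · have : v ∈ S.toSubmodule := Submodule.subset_span ⟨1, by simp⟩
    rw [h] at this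
    exact absurd ((Submodule.mem_bot ℂ).1 this) hv
  · have h2 := congrArg Subrepresentation.toSubmodule h
    exact h2

/-- In an irreducible representation, the translates of a nonzero functional separate vectors. -/
theorem eq_zero_of_forall_apply_eq_zero {ρ : Representation ℂ (GL (Fin n) ℂ) V}
    (hirr : ρ.IsIrreducible) {φ : Module.Dual ℂ V} (hφ : φ ≠ 0) {u : V}
    (hu : ∀ g, φ (ρ g u) = 0) : u = 0 := by
  by_contra h
  apply hφ
  have hle : Submodule.span ℂ (Set.range fun g => ρ g u) ≤ LinearMap.ker φ := by
    rw [Submodule.span_le]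
    rintro _ ⟨g, rfl⟩
    exact hu g
  rw [span_orbit_eq_top hirr h, top_le_iff, LinearMap.ker_eq_top] at hle
  exact hle

end GLRep

/-! ### The matrix coefficient of the highest weight vector. -/

namespace GLRep

variable {n : ℕ} {V : Type*} [AddCommGroup V] [Module ℂ V]

/-- Conjugation by `diag(s ^ i)` contracts lower unipotent matrices to `1` as `s → 0`. Taking the
coefficient of the weight of `v` under this one-parameter group therefore replaces `g` by `1`. -/
theorem exists_dual_eq_one_of_lowerUnipotent {ρ : Representation ℂ (GL (Fin n) ℂ) V}
    (h : IsAlgebraic ρ) {μ : Fin n → ℤ} {v : V} (hv : v ∈ weightSpace ρ μ) (hv0 : v ≠ 0) :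
    ∃ φ : Module.Dual ℂ V, ∀ g : GL (Fin n) ℂ, (∀ i, (g : Matrix (Fin n) (Fin n) ℂ) i i = 1) →
      (∀ i j, i < j → (g : Matrix (Fin n) (Fin n) ℂ) i j = 0) → φ (ρ g v) = 1 := by
  obtain ⟨φ₀, hφ₀⟩ : ∃ φ : Module.Dual ℂ V, φ v = 1 := by
    by_contra! hne
    apply hv0
    rw [← Module.forall_dual_apply_eq_zero_iff ℂ]
    intro φ
    by_contra hφ
    exact hne ((φ v)⁻¹ • φ) (by simp [hφ])
  let τ : ℂˣ → GL (Fin n) ℂ := fun s => torus fun i => s ^ (i : ℕ)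
  obtain ⟨L, hL, hL'⟩ := exists_character_coeff (unitsChar (∑ i : Fin n, (i : ℤ) * μ i))
  let φ : Module.Dual ℂ V :=
    { toFun := fun u => L fun s => φ₀ (ρ (τ s) u)
      map_add' := fun u u' => by rw [← map_add]; congr 1; funext t; simp
      map_smul' := fun c u => by rw [RingHom.id_apply, ← map_smul]; congr 1; funext t; simp }
  refine ⟨φ, fun g hg hg' => ?_⟩
  obtain ⟨P, k, hP⟩ := h φ₀ v
  have hdet : (g : Matrix (Fin n) (Fin n) ℂ).det = 1 := by
    rw [det_of_isLowerTriangular _ fun i j hij => hg' i j hij]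
    simp [hg]
  -- Truncated subtraction is harmless: for `i < j` the entry of `g` is zero.
  let Q : Polynomial ℂ := MvPolynomial.aeval (fun ij : Fin n × Fin n =>
    Polynomial.C ((g : Matrix (Fin n) (Fin n) ℂ) ij.1 ij.2) *
      Polynomial.X ^ ((ij.1 : ℕ) - (ij.2 : ℕ))) P
  have hQ (s : ℂ) : Q.eval s = MvPolynomial.eval (fun ij : Fin n × Fin n =>
      (g : Matrix (Fin n) (Fin n) ℂ) ij.1 ij.2 * s ^ ((ij.1 : ℕ) - (ij.2 : ℕ))) P := by
    rw [← Polynomial.coe_evalRingHom, ← MvPolynomial.coe_aeval_eq_eval]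
    change Polynomial.aeval s Q = _
    rw [MvPolynomial.comp_aeval_apply]
    simp
  have hQ0 : Q.coeff 0 = 1 := by
    have h1 := hP 1
    rw [map_one, Module.End.one_apply, hφ₀, Units.val_one, det_one, one_pow, div_one] at h1
    rw [Polynomial.coeff_zero_eq_eval_zero, hQ, h1]
    congr 2
    funext ⟨i, j⟩
    rcases lt_trichotomy i j with hij | rfl | hij
    · rw [hg' i j hij, one_apply_ne hij.ne, zero_mul]
    · simp [hg]
    · have : (i : ℕ) - j ≠ 0 := by have : (j : ℕ) < i := hij; omega
      rw [one_apply_ne hij.ne', zero_pow this, mul_zero]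
  have hτ (s : ℂˣ) : φ₀ (ρ (τ s) (ρ g v)) =
      unitsChar (∑ i : Fin n, (i : ℤ) * μ i) s * Q.eval (s : ℂ) := by
    have h1 : ρ (τ s) (ρ g v) = ρ (τ s * g * (τ s)⁻¹) (ρ (τ s) v) := by
      simp only [← Module.End.mul_apply, ← map_mul]
      congr 2
      group
    have h2 : ∏ i : Fin n, ((s ^ (i : ℕ) : ℂˣ) : ℂ) ^ μ i = unitsChar (∑ i : Fin n, (i : ℤ) * μ i) s := by
      rw [unitsChar_apply]
      have (f : Fin n → ℤ) : (s : ℂ) ^ (∑ i, f i) = ∏ i, (s : ℂ) ^ f i := by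
        have := map_sum (zmultiplesHom (Additive ℂˣ) (Additive.ofMul s)) f Finset.univ
        have h3 : s ^ (∑ i, f i) = ∏ i, s ^ f i := this
        have := congrArg (Units.val) h3
        simpa using this
      rw [this]
      refine Finset.prod_congr rfl fun i _ => ?_
      rw [_root_.zpow_mul]
      simp
    rw [h1, hv, h2, map_smul, map_smul, hP, smul_eq_mul, hQ]
    have hd : ((τ s * g * (τ s)⁻¹ : GL (Fin n) ℂ) : Matrix (Fin n) (Fin n) ℂ).det = 1 := by
      rw [Units.val_mul, Units.val_mul, det_mul, det_mul, mul_right_comm, ← det_mul,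
        ← Units.val_mul, mul_inv_cancel, Units.val_one, det_one, one_mul, hdet]
    rw [hd, one_pow, div_one]
    congr 3
    funext ⟨i, j⟩
    have hinv : (((τ s)⁻¹ : GL (Fin n) ℂ) : Matrix (Fin n) (Fin n) ℂ) =
      Matrix.diagonal fun i : Fin n => (((s ^ (i : ℕ) : ℂˣ) : ℂ))⁻¹ := rfl
    rw [Units.val_mul, Units.val_mul, hinv, coe_torus, mul_diagonal, diagonal_mul]
    rcases lt_or_ge i j with hij | hij
    · simp [hg' i j hij]
    · obtain ⟨d, hd⟩ := Nat.exists_eq_add_of_le (show (j : ℕ) ≤ i from hij)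
      simp only [hd, Units.val_pow_eq_pow_val, Nat.add_sub_cancel_left]
      have := s.ne_zero
      field_simp
      ring
  change (L fun s => φ₀ (ρ (τ s) (ρ g v))) = 1
  have hexp : (fun s => φ₀ (ρ (τ s) (ρ g v))) = ∑ j ∈ Finset.range (Q.natDegree + 1),
      Q.coeff j • (unitsChar (∑ i : Fin n, (i : ℤ) * μ i + j) : ℂˣ → ℂ) := by
    funext s
    rw [hτ, Polynomial.eval_eq_sum_range, Finset.mul_sum, Finset.sum_apply]
    refine Finset.sum_congr rfl fun j _ => ?_
    rw [Pi.smul_apply, unitsChar_apply, unitsChar_apply, zpow_add₀ s.ne_zero, smul_eq_mul,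
      zpow_natCast]
    ring
  rw [hexp, map_sum, Finset.sum_eq_single 0]
  · simp [hL, hQ0]
  · intro j _ hj
    rw [map_smul, hL', smul_zero]
    intro heq
    have := unitsChar_injective heq
    simp at this
    exact hj this
  · simp

/-- The upper left `2 × 2` minor. -/
def minorTwo (g : Matrix (Fin 3) (Fin 3) ℂ) : ℂ := g 0 0 * g 1 1 - g 0 1 * g 1 0

/-- Gauss decomposition `g = N * diag * U`: `U` fixes `v`, the diagonal part scales it, and `φ` is
`1` on `ρ N v`. -/
theorem apply_eq_of_minors_ne_zero {ρ : Representation ℂ (GL (Fin 3) ℂ) V} {lam : Fin 3 → ℤ}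
    {v : V} (hv : v ∈ weightSpace ρ lam) (hu : ∀ u : GL (Fin 3) ℂ, IsUpperUnipotent u → ρ u v = v)
    {φ : Module.Dual ℂ V}
    (hφ : ∀ g : GL (Fin 3) ℂ, (∀ i, (g : Matrix (Fin 3) (Fin 3) ℂ) i i = 1) →
      (∀ i j, i < j → (g : Matrix (Fin 3) (Fin 3) ℂ) i j = 0) → φ (ρ g v) = 1)
    (g : GL (Fin 3) ℂ) (h1 : (g : Matrix (Fin 3) (Fin 3) ℂ) 0 0 ≠ 0)
    (h2 : minorTwo (g : Matrix (Fin 3) (Fin 3) ℂ) ≠ 0) :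
    φ (ρ g v) = (g : Matrix (Fin 3) (Fin 3) ℂ) 0 0 ^ lam 0 *
      (minorTwo (g : Matrix (Fin 3) (Fin 3) ℂ) / (g : Matrix (Fin 3) (Fin 3) ℂ) 0 0) ^ lam 1 *
      ((g : Matrix (Fin 3) (Fin 3) ℂ).det / minorTwo (g : Matrix (Fin 3) (Fin 3) ℂ)) ^ lam 2 := by
  set A : Matrix (Fin 3) (Fin 3) ℂ := (g : Matrix (Fin 3) (Fin 3) ℂ) with hA
  have h3 : A.det ≠ 0 := (GeneralLinearGroup.det g).ne_zero
  let N : Matrix (Fin 3) (Fin 3) ℂ := !![1, 0, 0; A 1 0 / A 0 0, 1, 0; A 2 0 / A 0 0,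
    (A 0 0 * A 2 1 - A 2 0 * A 0 1) / minorTwo A, 1]
  let U : Matrix (Fin 3) (Fin 3) ℂ := !![1, A 0 1 / A 0 0, A 0 2 / A 0 0;
    0, 1, (A 0 0 * A 1 2 - A 0 2 * A 1 0) / minorTwo A; 0, 0, 1]
  have hN : N.det = 1 := by simp [N, det_fin_three]
  have hU : U.det = 1 := by simp [U, det_fin_three]
  let s : Fin 3 → ℂˣ := ![Units.mk0 _ h1, Units.mk0 _ (div_ne_zero h2 h1),
    Units.mk0 _ (div_ne_zero h3 h2)]
  let N' := GeneralLinearGroup.mkOfDetNeZero N (by rw [hN]; exact one_ne_zero)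
  let U' := GeneralLinearGroup.mkOfDetNeZero U (by rw [hU]; exact one_ne_zero)
  have hg : g = N' * torus s * U' := by
    apply Units.ext
    rw [Units.val_mul, Units.val_mul, coe_torus]
    change A = N * _ * U
    ext i j
    rw [mul_assoc, mul_apply, Fin.sum_univ_three]
    simp only [diagonal_mul]
    fin_cases i <;> fin_cases j <;> simp [N, U, s]
    all_goals field_simp
    · simp only [minorTwo]; ring
    · ring
    · ring
    · rw [det_fin_three]; simp only [minorTwo]; ring
  have hU' : ρ U' v = v := by
    refine hu _ ⟨fun i => ?_, fun i j hij => ?_⟩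
    · change U i i = 1
      fin_cases i <;> simp [U]
    · change U i j = 0
      fin_cases i <;> fin_cases j <;> simp [U] at hij ⊢
  rw [hg, map_mul, map_mul, Module.End.mul_apply, Module.End.mul_apply, hU', hv, map_smul,
    map_smul, hφ]
  · simp [Fin.prod_univ_three, s]
  · change ∀ i, N i i = 1
    intro i
    fin_cases i <;> simp [N]
  · change ∀ i j, i < j → N i j = 0
    intro i j hij
    fin_cases i <;> fin_cases j <;> simp [N] at hij ⊢

/-- The matrix coefficient between the highest weight vector and the dual lowest weight vector is
a product of powers of leading principal minors. -/
theorem exists_dual_apply_eq_minors {ρ : Representation ℂ (GL (Fin 3) ℂ) V} (halg : IsAlgebraic ρ)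
    {lam : Fin 3 → ℤ} {v : V} (hv : v ∈ weightSpace ρ lam) (hv0 : v ≠ 0)
    (hu : ∀ u : GL (Fin 3) ℂ, IsUpperUnipotent u → ρ u v = v)
    {p q r : ℕ} (hp : lam 0 = lam 1 + p) (hq : lam 1 = lam 2 + q) (hr : lam 2 = -r) :
    ∃ φ : Module.Dual ℂ V, ∀ g : GL (Fin 3) ℂ,
      φ (ρ g v) = (g : Matrix (Fin 3) (Fin 3) ℂ) 0 0 ^ p *
        minorTwo (g : Matrix (Fin 3) (Fin 3) ℂ) ^ q / (g : Matrix (Fin 3) (Fin 3) ℂ).det ^ r := by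
  obtain ⟨φ, hφ⟩ := exists_dual_eq_one_of_lowerUnipotent halg hv hv0
  refine ⟨φ, ?_⟩
  obtain ⟨P, k, hP⟩ := halg φ v
  let X : Matrix (Fin 3) (Fin 3) (MvPolynomial (Fin 3 × Fin 3) ℂ) :=
    fun i j => MvPolynomial.X (i, j)
  let D : MvPolynomial (Fin 3 × Fin 3) ℂ := X 0 0 * X 1 1 - X 0 1 * X 1 0
  have hX (A : Matrix (Fin 3) (Fin 3) ℂ) :
      MvPolynomial.eval (fun ij : Fin 3 × Fin 3 => A ij.1 ij.2) X.det = A.det := by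
    rw [RingHom.map_det]
    congr 1
    ext i j
    exact MvPolynomial.eval_X _
  have hD (A : Matrix (Fin 3) (Fin 3) ℂ) :
      MvPolynomial.eval (fun ij : Fin 3 × Fin 3 => A ij.1 ij.2) D = minorTwo A := by
    simp [D, X, minorTwo]
  have hX00 (A : Matrix (Fin 3) (Fin 3) ℂ) :
      MvPolynomial.eval (fun ij : Fin 3 × Fin 3 => A ij.1 ij.2) (X 0 0) = A 0 0 := by simp [X]
  -- The formula is known only on the big cell. The last factor vanishes off it, so the identity
  -- holds everywhere; that factor then cancels in the polynomial domain.
  have hprod : (P * X.det ^ r - X 0 0 ^ p * D ^ q * X.det ^ k) * (X 0 0 * D * X.det) = 0 := by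
    refine MvPolynomial.funext fun x => ?_
    obtain ⟨A, rfl⟩ : ∃ A : Matrix (Fin 3) (Fin 3) ℂ, x = fun ij => A ij.1 ij.2 :=
      ⟨fun i j => x (i, j), rfl⟩
    simp only [map_mul, map_sub, map_pow, hX, hD, hX00, map_zero]
    by_cases h1 : A 0 0 = 0
    · simp [h1]
    by_cases h2 : minorTwo A = 0
    · simp [h2]
    by_cases h3 : A.det = 0
    · simp [h3]
    have h4 := hP (GeneralLinearGroup.mkOfDetNeZero A h3)
    rw [apply_eq_of_minors_ne_zero hv hu hφ _ h1 h2] at h4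
    change A 0 0 ^ lam 0 * (minorTwo A / A 0 0) ^ lam 1 * (A.det / minorTwo A) ^ lam 2 =
      MvPolynomial.eval (fun ij : Fin 3 × Fin 3 => A ij.1 ij.2) P / A.det ^ k at h4
    rw [eq_div_iff (pow_ne_zero _ h3)] at h4
    rw [← h4]
    apply mul_eq_zero_of_left
    rw [hp, hq, hr, zpow_add₀ h1, zpow_add₀ (div_ne_zero h2 h1), zpow_add₀ h1]
    simp only [_root_.zpow_neg, zpow_natCast, div_pow]
    field_simp
    ring
  have hne : X 0 0 * D * X.det ≠ 0 := by
    intro h0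
    have := congrArg (MvPolynomial.eval fun ij : Fin 3 × Fin 3 =>
      (1 : Matrix (Fin 3) (Fin 3) ℂ) ij.1 ij.2) h0
    simp only [map_mul, hX, hD, hX00, map_zero] at this
    simp [minorTwo] at this
  have hzero := (mul_eq_zero.1 hprod).resolve_right hne
  intro g
  have h3 : (g : Matrix (Fin 3) (Fin 3) ℂ).det ≠ 0 := (GeneralLinearGroup.det g).ne_zero
  have := congrArg (MvPolynomial.eval fun ij : Fin 3 × Fin 3 =>
    (g : Matrix (Fin 3) (Fin 3) ℂ) ij.1 ij.2) hzero
  simp only [map_mul, map_sub, map_pow, hX, hD, hX00, map_zero] at this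
  rw [hP, div_eq_div_iff (pow_ne_zero _ h3) (pow_ne_zero _ h3)]
  linear_combination this

end GLRep

/-! ### Constant terms and kernels of bounded rank. -/

namespace GLRep

/-- The coefficient of a character in a product of powers of linear forms in the torus coordinates
and their inverses. -/
theorem coeff_pow_mul_pow {n : ℕ} (L : ((Fin n → ℂˣ) → ℂ) →ₗ[ℂ] ℂ) (hL : L (torusChar 0) = 1)
    (hL' : ∀ χ : (Fin n → ℂˣ) →* ℂ, χ ≠ torusChar 0 → L χ = 0) (X Y : Fin n → ℂ) (p q : ℕ)
    (b : ℤ) :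
    (L fun t => (∑ i, X i * t i) ^ p * (∑ i, Y i * (t i : ℂ)⁻¹) ^ q * ∏ i, (t i : ℂ) ^ b) =
      ∑ α ∈ Finset.univ.piAntidiag p, ∑ β ∈ Finset.univ.piAntidiag q,
        if ∀ i, (α i : ℤ) - β i + b = 0 then
          (Nat.multinomial Finset.univ α * ∏ i, X i ^ α i) *
            (Nat.multinomial Finset.univ β * ∏ i, Y i ^ β i) else 0 := by
  have hexp : (fun t : Fin n → ℂˣ =>
      (∑ i, X i * t i) ^ p * (∑ i, Y i * (t i : ℂ)⁻¹) ^ q * ∏ i, (t i : ℂ) ^ b) =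
      ∑ α ∈ Finset.univ.piAntidiag p, ∑ β ∈ Finset.univ.piAntidiag q,
        ((Nat.multinomial Finset.univ α * ∏ i, X i ^ α i) *
            (Nat.multinomial Finset.univ β * ∏ i, Y i ^ β i)) •
          (torusChar (fun i => (α i : ℤ) - β i + b) : (Fin n → ℂˣ) → ℂ) := by
    funext t
    rw [Finset.sum_pow_eq_sum_piAntidiag, Finset.sum_pow_eq_sum_piAntidiag, Finset.sum_mul_sum,
      Finset.sum_mul, Finset.sum_apply]
    refine Finset.sum_congr rfl fun α _ => ?_
    rw [Finset.sum_mul, Finset.sum_apply]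
    refine Finset.sum_congr rfl fun β _ => ?_
    have : torusChar (fun i => (α i : ℤ) - β i + b) t =
        (∏ i, (t i : ℂ) ^ α i) * (∏ i, (t i : ℂ)⁻¹ ^ β i) * ∏ i, (t i : ℂ) ^ b := by
      rw [torusChar_apply, ← Finset.prod_mul_distrib, ← Finset.prod_mul_distrib]
      refine Finset.prod_congr rfl fun i _ => ?_
      rw [_root_.zpow_add₀ (t i).ne_zero, zpow_sub₀ (t i).ne_zero, zpow_natCast, zpow_natCast, inv_pow,
        div_eq_mul_inv]
    rw [Pi.smul_apply, this]
    simp only [mul_pow, Finset.prod_mul_distrib, smul_eq_mul]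
    ring
  rw [hexp, map_sum]
  refine Finset.sum_congr rfl fun α _ => ?_
  rw [map_sum]
  refine Finset.sum_congr rfl fun β _ => ?_
  rw [map_smul]
  split_ifs with h
  · have : (fun i => (α i : ℤ) - β i + b) = 0 := funext h
    rw [this, hL, smul_eq_mul, mul_one]
  · rw [hL', smul_zero]
    intro heq
    exact h fun i => congrFun (torusChar_injective heq) i

/-- The constraint determines `β` from `α`, with the right total degree, so only monomials in the
products `X i * Y i` survive besides `(∏ Y i) ^ s`. -/
theorem sum_piAntidiag_shift (p s : ℕ) (X Y : Fin 3 → ℂ) :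
    (∑ α ∈ Finset.univ.piAntidiag p, ∑ β ∈ Finset.univ.piAntidiag (p + 3 * s),
        if ∀ i, β i = α i + s then
          (Nat.multinomial Finset.univ α * ∏ i, X i ^ α i) *
            (Nat.multinomial Finset.univ β * ∏ i, Y i ^ β i) else 0) =
      (∏ i, Y i) ^ s * ∑ α ∈ Finset.univ.piAntidiag p,
        ((Nat.multinomial Finset.univ α * Nat.multinomial Finset.univ fun i => α i + s : ℝ) : ℂ) *
          ∏ i, (X i * Y i) ^ α i := by
  rw [Finset.mul_sum]
  refine Finset.sum_congr rfl fun α hα => ?_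
  rw [Finset.sum_eq_single fun i => α i + s]
  · rw [if_pos fun _ => rfl]
    simp only [pow_add, mul_pow, Finset.prod_mul_distrib, Finset.prod_pow]
    push_cast
    ring
  · intro β _ hβ
    rw [if_neg]
    exact fun h => hβ (funext h)
  · intro h
    exfalso
    apply h
    rw [Finset.mem_piAntidiag] at hα ⊢
    refine ⟨?_, by simp⟩
    rw [Finset.sum_add_distrib, hα.1]
    simp

section Kernel

variable {V : Type*} [AddCommGroup V] [Module ℂ V] {G : Type*}

/-- Monomials of degree `m` in three variables with sum zero reduce to monomials in two. -/
theorem monomial_mem_span (m : ℕ) (k : G → ℂ) (A : G → Fin 3 → ℂ) (hA : ∀ g, ∑ i, A g i = 0)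
    {γ : Fin 3 → ℕ} (hγ : γ ∈ Finset.univ.piAntidiag m) :
    (fun g => k g * ∏ i, A g i ^ γ i) ∈ Submodule.span ℂ
      (Set.range fun (j : Fin (m + 1)) (g : G) => k g * (A g 0 ^ (j : ℕ) * A g 1 ^ (m - j))) := by
  have hm : γ 0 + γ 1 + γ 2 = m := by
    rw [← (Finset.mem_piAntidiag.1 hγ).1, Fin.sum_univ_three]
  have hexp : (fun g => k g * ∏ i, A g i ^ γ i) = ∑ l ∈ Finset.range (γ 2 + 1),
      ((-1) ^ γ 2 * ((γ 2).choose l : ℂ)) •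
        fun g => k g * (A g 0 ^ (γ 0 + l) * A g 1 ^ (m - (γ 0 + l))) := by
    funext g
    have h2 : A g 2 = -1 * (A g 0 + A g 1) := by
      have := hA g
      rw [Fin.sum_univ_three] at this
      linear_combination this
    rw [Fin.prod_univ_three, h2, mul_pow, add_pow, Finset.sum_apply, Finset.mul_sum,
      Finset.mul_sum, Finset.mul_sum]
    refine Finset.sum_congr rfl fun l hl => ?_
    have hl' : m - (γ 0 + l) = γ 1 + (γ 2 - l) := by
      have := Finset.mem_range.1 hl
      omega
    rw [Pi.smul_apply, smul_eq_mul, hl', pow_add, pow_add]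
    ring
  rw [hexp]
  refine Submodule.sum_mem _ fun l hl => Submodule.smul_mem _ _ (Submodule.subset_span ?_)
  have := Finset.mem_range.1 hl
  exact ⟨⟨γ 0 + l, by omega⟩, rfl⟩

/-- If a separating family of functionals has a kernel on a spanning family which is a combination
of the monomials of degree `m` in three variables with sum zero, then the dimension is at most
`m + 1`. -/
theorem finrank_le_of_kernel [FiniteDimensional ℂ V] {H : Type*} {W : Submodule ℂ V}
    {e : H → V} (he : W ≤ Submodule.span ℂ (Set.range e))
    (ψ : G → Module.Dual ℂ V) (hψ : ∀ u ∈ W, (∀ g, ψ g u = 0) → u = 0)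
    {m : ℕ} {c : (Fin 3 → ℕ) → ℝ} {k : G → ℂ} {k' : H → ℂ} {A : G → Fin 3 → ℂ}
    {B : H → Fin 3 → ℂ} (hA : ∀ g, ∑ i, A g i = 0)
    (hK : ∀ g h, ψ g (e h) = k g * k' h *
      ∑ γ ∈ Finset.univ.piAntidiag m, c γ * ∏ i, (A g i * B h i) ^ γ i) :
    Module.finrank ℂ W ≤ m + 1 := by
  let Ψ : V →ₗ[ℂ] (G → ℂ) := LinearMap.pi ψ
  set S := Submodule.span ℂ
    (Set.range fun (j : Fin (m + 1)) (g : G) => k g * (A g 0 ^ (j : ℕ) * A g 1 ^ (m - j)))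
  have hS : Module.finrank ℂ S ≤ m + 1 := by
    have h := finrank_range_le_card (R := ℂ)
      fun (j : Fin (m + 1)) (g : G) => k g * (A g 0 ^ (j : ℕ) * A g 1 ^ (m - j))
    rwa [Fintype.card_fin] at h
  have hmem : ∀ u ∈ W, Ψ u ∈ S := by
    have : Submodule.span ℂ (Set.range e) ≤ S.comap Ψ := by
      rw [Submodule.span_le]
      rintro _ ⟨h, rfl⟩
      change Ψ (e h) ∈ S
      have hexp : Ψ (e h) = ∑ γ ∈ Finset.univ.piAntidiag m,
          (k' h * c γ * ∏ i, B h i ^ γ i) • fun g => k g * ∏ i, A g i ^ γ i := by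
        funext g
        change ψ g (e h) = _
        rw [hK, Finset.sum_apply, Finset.mul_sum]
        refine Finset.sum_congr rfl fun γ _ => ?_
        simp only [Pi.smul_apply, smul_eq_mul, mul_pow, Finset.prod_mul_distrib]
        ring
      rw [hexp]
      exact Submodule.sum_mem _ fun γ hγ =>
        Submodule.smul_mem _ _ (monomial_mem_span m k A hA hγ)
    exact fun u hu => this (he hu)
  have : FiniteDimensional ℂ S := FiniteDimensional.span_of_finite ℂ (Set.finite_range _)
  let f : W →ₗ[ℂ] S := (Ψ.comp W.subtype).codRestrict S fun u => hmem u u.2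
  have hf : Function.Injective f := by
    rw [injective_iff_map_eq_zero]
    intro u hu
    apply Subtype.ext
    refine hψ u u.2 fun g => ?_
    exact congrFun (congrArg Subtype.val hu) g
  exact (LinearMap.finrank_le_finrank_of_injective hf).trans hS

/-- If a kernel is a positive combination of the monomials of degree `m` in three variables,
evaluated at `m + 1` real points `(1, z, -1 - z)`, then its Gram matrix is nondegenerate. -/
theorem le_finrank_of_kernel [FiniteDimensional ℂ V] {W : Submodule ℂ V} {m : ℕ}
    {e : Fin (m + 1) → V} (he : ∀ i, e i ∈ W) (ψ : Fin (m + 1) → Module.Dual ℂ V)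
    {c : (Fin 3 → ℕ) → ℝ} (hc : ∀ γ, 0 < c γ) {k k' : Fin (m + 1) → ℂ} (hk : ∀ i, k i ≠ 0)
    (hk' : ∀ i, k' i ≠ 0) {z : Fin (m + 1) → ℝ} (hz : Function.Injective z)
    (hK : ∀ i j, ψ i (e j) = k i * k' j * ∑ γ ∈ Finset.univ.piAntidiag m, c γ *
      ∏ l, ((![1, z i, -1 - z i] l : ℝ) * (![1, z j, -1 - z j] l : ℝ) : ℂ) ^ γ l) :
    m + 1 ≤ Module.finrank ℂ W := by
  let e' : Fin (m + 1) → W := fun i => ⟨e i, he i⟩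
  suffices h : LinearIndependent ℂ e' by simpa using h.fintype_card_le_finrank
  rw [Fintype.linearIndependent_iff]
  intro a ha
  have ha' : ∑ j, a j • e j = 0 := by
    have := congrArg Subtype.val ha
    simpa [e'] using this
  let w : Fin (m + 1) → ℂ := fun j => a j * k' j
  let E : (Fin 3 → ℕ) → Fin (m + 1) → ℝ := fun γ i => ∏ l, ![1, z i, -1 - z i] l ^ γ l
  have hrow (i) : ∑ γ ∈ Finset.univ.piAntidiag m, (c γ : ℂ) * E γ i * ∑ j, w j * E γ j = 0 := by
    have h1 := congrArg (ψ i) ha'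
    rw [map_zero, map_sum] at h1
    have h2 : ∑ j, ψ i (a j • e j) =
        k i * ∑ γ ∈ Finset.univ.piAntidiag m, (c γ : ℂ) * E γ i * ∑ j, w j * E γ j := by
      simp only [map_smul, hK, smul_eq_mul, Finset.mul_sum]
      rw [Finset.sum_comm]
      refine Finset.sum_congr rfl fun γ _ => Finset.sum_congr rfl fun j _ => ?_
      simp only [mul_pow, Finset.prod_mul_distrib, E, w]
      push_cast
      ring
    rw [h2] at h1
    exact (mul_eq_zero.1 h1).resolve_left (hk i)
  -- Pairing `hrow` with the conjugate of `w` gives a sum of squares, because `E` is real.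
  have hnorm : ∑ γ ∈ Finset.univ.piAntidiag m, c γ * Complex.normSq (∑ j, w j * E γ j) = 0 := by
    apply Complex.ofReal_injective
    have : ∑ i, starRingEnd ℂ (w i) *
        ∑ γ ∈ Finset.univ.piAntidiag m, (c γ : ℂ) * E γ i * ∑ j, w j * E γ j = 0 := by
      simp [hrow]
    rw [Complex.ofReal_zero, ← this, Complex.ofReal_sum]
    simp only [Finset.mul_sum (Finset.piAntidiag Finset.univ m)]
    rw [Finset.sum_comm]
    refine Finset.sum_congr rfl fun γ _ => ?_
    rw [Complex.ofReal_mul, ← Complex.mul_conj, map_sum, mul_comm (∑ j, w j * (E γ j : ℂ)),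
      Finset.sum_mul, Finset.mul_sum]
    refine Finset.sum_congr rfl fun i _ => ?_
    simp only [map_mul, Complex.conj_ofReal]
    ring
  have hzero : ∀ γ ∈ Finset.univ.piAntidiag m, ∑ j, w j * E γ j = 0 := by
    intro γ hγ
    have := (Finset.sum_eq_zero_iff_of_nonneg fun γ _ =>
      mul_nonneg (hc γ).le (Complex.normSq_nonneg _)).1 hnorm γ hγ
    exact Complex.normSq_eq_zero.1 ((mul_eq_zero.1 this).resolve_left (hc γ).ne')
  have hw : w = 0 := by
    refine Matrix.eq_zero_of_forall_pow_sum_mul_pow_eq_zero (f := fun i => (z i : ℂ))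
      (fun i j h => hz (Complex.ofReal_injective h)) fun l => ?_
    -- For this exponent `E` is `z ^ l`, so Vandermonde at distinct nodes kills `w`.
    have h1 := hzero ![m - l, l, 0] (by
      rw [Finset.mem_piAntidiag]
      refine ⟨?_, by simp⟩
      rw [Fin.sum_univ_three]
      simp
      omega)
    simpa [E, Fin.prod_univ_three] using h1
  intro i
  exact (mul_eq_zero.1 (congrFun hw i)).resolve_right (hk' i)

end Kernel

end GLRep

/-! ### The kernel of the zero weight projection. -/

namespace GLRep

/-- The cross product of the first two rows. -/
def rowCross (g : Matrix (Fin 3) (Fin 3) ℂ) : Fin 3 → ℂ :=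
  ![g 0 1 * g 1 2 - g 0 2 * g 1 1, g 0 2 * g 1 0 - g 0 0 * g 1 2, g 0 0 * g 1 1 - g 0 1 * g 1 0]

theorem sum_row_mul_rowCross (g : Matrix (Fin 3) (Fin 3) ℂ) :
    ∑ i, g 0 i * rowCross g i = 0 := by
  rw [Fin.sum_univ_three]
  simp [rowCross]
  ring

/-- Cauchy–Binet: the principal `2 × 2` minor of `diag(t)` omitting index `i` is `∏ t / t_i`. -/
theorem minorTwo_mul_diagonal_mul (g h : Matrix (Fin 3) (Fin 3) ℂ) (t : Fin 3 → ℂˣ) :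
    minorTwo (g * diagonal (fun i => (t i : ℂ)) * h) =
      (∑ i, rowCross g i * rowCross hᵀ i * (t i : ℂ)⁻¹) * ∏ i, (t i : ℂ) := by
  have h0 := (t 0).ne_zero
  have h1 := (t 1).ne_zero
  have h2 := (t 2).ne_zero
  rw [Fin.sum_univ_three, Fin.prod_univ_three]
  simp only [minorTwo, mul_apply (M := g * _), Fin.sum_univ_three, mul_diagonal, rowCross,
    transpose_apply, cons_val_zero, cons_val_one, cons_val]
  field_simp
  ring

variable {V : Type*} [AddCommGroup V] [Module ℂ V] [FiniteDimensional ℂ V]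

/-- The matrix with first row `(1, 1, 1)` and first two rows of cross product `(1, z, -1 - z)`. -/
def testMatrix (z : ℝ) : Matrix (Fin 3) (Fin 3) ℂ :=
  !![1, 1, 1; 0, -1 - z, -z; 0, -1, -1]

theorem det_testMatrix (z : ℝ) : (testMatrix z).det = 1 := by
  simp [testMatrix, det_fin_three]

theorem testMatrix_row (z : ℝ) (i : Fin 3) : testMatrix z 0 i = 1 := by
  fin_cases i <;> simp [testMatrix]

theorem rowCross_testMatrix (z : ℝ) (i : Fin 3) :
    rowCross (testMatrix z) i = (![1, z, -1 - z] i : ℝ) := by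
  fin_cases i <;> simp [testMatrix, rowCross]
  ring

/-- The matrix coefficients of the projection to the zero weight space. -/
theorem exists_projection_matrixCoeff {ρ : Representation ℂ (GL (Fin 3) ℂ) V}
    (halg : IsAlgebraic ρ) {lam : Fin 3 → ℤ} (hwt : HasHighestWeight ρ lam)
    {p q r : ℕ} (hp : lam 0 = lam 1 + p) (hq : lam 1 = lam 2 + q) (hr : lam 2 = -r) :
    ∃ (v : V) (φ : Module.Dual ℂ V) (P : V →ₗ[ℂ] V), v ≠ 0 ∧ φ ≠ 0 ∧
      (∀ u, P u ∈ zeroWeightSpace ρ) ∧ (∀ u ∈ zeroWeightSpace ρ, P u = u) ∧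
      ∀ g h : GL (Fin 3) ℂ, φ (ρ g (P (ρ h v))) = (g.val.det ^ r)⁻¹ * (h.val.det ^ r)⁻¹ *
        ∑ α ∈ Finset.univ.piAntidiag p, ∑ β ∈ Finset.univ.piAntidiag q,
          if ∀ i, (α i : ℤ) - β i + lam 1 = 0 then
            (Nat.multinomial Finset.univ α * ∏ i, (g.val 0 i * h.val i 0) ^ α i) *
              (Nat.multinomial Finset.univ β *
                ∏ i, (rowCross g.val i * rowCross h.valᵀ i) ^ β i) else 0 := by
  obtain ⟨v, hv, hv0, hu⟩ := hwt
  obtain ⟨φ, hφ⟩ := exists_dual_apply_eq_minors halg hv hv0 hu hp hq hr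
  obtain ⟨L, hL, hL'⟩ := exists_character_coeff (torusChar (0 : Fin 3 → ℤ))
  obtain ⟨P, hP, hP', hPL⟩ := exists_weight_projection halg 0 L hL hL'
  refine ⟨v, φ, P, hv0, ?_, hP, hP', fun g h => ?_⟩
  · rintro rfl
    have := hφ 1
    simp [minorTwo] at this
  · have h1 := hPL (φ.comp (ρ g)) (ρ h v)
    rw [LinearMap.comp_apply] at h1
    rw [h1, ← coeff_pow_mul_pow L hL hL', ← smul_eq_mul _ (L _), ← map_smul]
    congr 1
    funext t
    have h2 : (φ.comp (ρ g)) (ρ (torus t) (ρ h v)) = φ (ρ (g * torus t * h) v) := by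
      simp only [LinearMap.comp_apply, map_mul, Module.End.mul_apply]
    rw [h2, hφ, Units.val_mul, Units.val_mul, coe_torus, minorTwo_mul_diagonal_mul, det_mul,
      det_mul, det_diagonal]
    have h3 : (g.val * diagonal (fun i => (t i : ℂ)) * h.val) 0 0 =
        ∑ i, g.val 0 i * h.val i 0 * t i := by
      rw [mul_apply]
      refine Finset.sum_congr rfl fun i _ => ?_
      rw [mul_diagonal]
      ring
    have h4 : (∏ i, (t i : ℂ)) ≠ 0 := Finset.prod_ne_zero_iff.2 fun i _ => (t i).ne_zero
    have hg : g.val.det ≠ 0 := (GeneralLinearGroup.det g).ne_zero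
    have hh : h.val.det ≠ 0 := (GeneralLinearGroup.det h).ne_zero
    -- The minor contributes `(∏ t) ^ q` and the determinant `(∏ t) ^ (-r)`.
    have h5 : lam 1 = (q : ℤ) - r := by omega
    rw [h3]
    simp only [Pi.smul_apply, smul_eq_mul, Finset.prod_zpow, h5, _root_.zpow_sub₀ h4,
      zpow_natCast, mul_pow]
    field_simp

/-- Both kernel bounds apply. Nonvanishing of `κ` is needed only at the test matrices of the lower
bound. -/
theorem finrank_zeroWeightSpace {ρ : Representation ℂ (GL (Fin 3) ℂ) V} (hirr : ρ.IsIrreducible)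
    {v : V} (hv : v ≠ 0) {φ : Module.Dual ℂ V} (hφ : φ ≠ 0) {P : V →ₗ[ℂ] V}
    (hP : ∀ u, P u ∈ zeroWeightSpace ρ) (hP' : ∀ u ∈ zeroWeightSpace ρ, P u = u)
    {m r : ℕ} {c : (Fin 3 → ℕ) → ℝ} (hc : ∀ γ, 0 < c γ) {κ : (Fin 3 → ℂ) → (Fin 3 → ℂ) → ℂ}
    (hκ : ∀ x y, (∀ i, x i ≠ 0) → (∀ i, y i ≠ 0) → κ x y ≠ 0)
    (hK : ∀ g h : GL (Fin 3) ℂ, φ (ρ g (P (ρ h v))) =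
      (g.val.det ^ r)⁻¹ * κ (g.val 0) (rowCross g.val) *
      ((h.val.det ^ r)⁻¹ * κ (h.valᵀ 0) (rowCross h.valᵀ)) *
      ∑ γ ∈ Finset.univ.piAntidiag m, c γ *
        ∏ i, (g.val 0 i * rowCross g.val i * (h.val i 0 * rowCross h.valᵀ i)) ^ γ i) :
    Module.finrank ℂ (zeroWeightSpace ρ) = m + 1 := by
  apply le_antisymm
  · refine finrank_le_of_kernel (e := fun h => P (ρ h v)) (ψ := fun g => φ.comp (ρ g)) ?_
      (fun u _ hu => eq_zero_of_forall_apply_eq_zero hirr hφ hu)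
      (fun g => sum_row_mul_rowCross g.val) hK
    intro u hu
    have h1 : u ∈ Submodule.map P (Submodule.span ℂ (Set.range fun g => ρ g v)) := by
      rw [span_orbit_eq_top hirr hv]
      exact ⟨u, trivial, hP' u hu⟩
    rwa [Submodule.map_span, ← Set.range_comp] at h1
  -- Positive distinct nodes keep every coordinate of `(1, z, -1 - z)` nonzero, hence `κ` too.
  · let z : Fin (m + 1) → ℝ := fun i => (i : ℝ) + 1
    have hz0 (i) : 0 < z i := by positivity
    have hne (i) (l : Fin 3) : ((![1, z i, -1 - z i] l : ℝ) : ℂ) ≠ 0 := by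
      rw [Complex.ofReal_ne_zero]
      have := hz0 i
      fin_cases l
      · simp
      · simpa using this.ne'
      · have : -1 - z i < 0 := by linarith
        simpa using this.ne
    let g : Fin (m + 1) → GL (Fin 3) ℂ := fun i =>
      GeneralLinearGroup.mkOfDetNeZero (testMatrix (z i)) (by simp [det_testMatrix])
    let h : Fin (m + 1) → GL (Fin 3) ℂ := fun i =>
      GeneralLinearGroup.mkOfDetNeZero (testMatrix (z i))ᵀ (by simp [det_testMatrix])
    have hg (i) : (g i).val = testMatrix (z i) := rfl
    have hh (i) : (h i).val = (testMatrix (z i))ᵀ := rfl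
    have hk (i) : κ (testMatrix (z i) 0) (rowCross (testMatrix (z i))) ≠ 0 := by
      refine hκ _ _ (fun l => ?_) fun l => ?_
      · rw [testMatrix_row]
        exact one_ne_zero
      · rw [rowCross_testMatrix]
        exact hne i l
    refine le_finrank_of_kernel (e := fun i => P (ρ (h i) v)) (fun i => hP _)
      (fun i => φ.comp (ρ (g i))) hc hk hk (z := z) (fun i j hij => ?_) fun i j => ?_
    · simpa [z, Fin.ext_iff] using hij
    · rw [LinearMap.comp_apply, hK, hg, hh]
      simp only [det_transpose, det_testMatrix, one_pow, inv_one, one_mul, transpose_transpose,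
        transpose_apply, testMatrix_row, rowCross_testMatrix]

end GLRep

/-! ### The two signs of the middle weight. -/

theorem lemma5p1 {V : Type*} [AddCommGroup V] [Module ℂ V] [FiniteDimensional ℂ V]
    (ρ : Representation ℂ (GL (Fin 3) ℂ) V) (halg : GLRep.IsAlgebraic ρ)
    (hirr : ρ.IsIrreducible) (lam : Fin 3 → ℤ) (h01 : lam 1 ≤ lam 0) (h12 : lam 2 ≤ lam 1)
    (hwt : GLRep.HasHighestWeight ρ lam) (hsum : lam 0 + lam 1 + lam 2 = 0) :
    (0 ≤ lam 1 →
      (Module.finrank ℂ (GLRep.zeroWeightSpace ρ) : ℤ) = lam 0 - lam 1 + 1) ∧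
    (lam 1 ≤ 0 →
      (Module.finrank ℂ (GLRep.zeroWeightSpace ρ) : ℤ) = lam 1 - lam 2 + 1) := by
  obtain ⟨p, hp⟩ := Int.le.dest h01
  obtain ⟨q, hq⟩ := Int.le.dest h12
  obtain ⟨r, hr⟩ := Int.le.dest (show lam 2 ≤ 0 by omega)
  obtain ⟨v, φ, P, hv, hφ, hP, hP', hK⟩ :=
    GLRep.exists_projection_matrixCoeff halg hwt (p := p) (q := q) (r := r) hp.symm hq.symm
      (by omega)
  have hpos (s : ℕ) (γ : Fin 3 → ℕ) : (0 : ℝ) < Nat.multinomial Finset.univ γ *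
      Nat.multinomial Finset.univ fun i => γ i + s :=
    mul_pos (Nat.cast_pos.2 (Nat.multinomial_pos _ _)) (Nat.cast_pos.2 (Nat.multinomial_pos _ _))
  constructor
  · intro hb
    obtain ⟨s, hs⟩ := Int.eq_ofNat_of_zero_le hb
    -- Weight sum zero says `q - p = 3 * lam 1`, so here `m = p` and `α` is the free exponent.
    obtain rfl : q = p + 3 * s := by omega
    rw [GLRep.finrank_zeroWeightSpace hirr hv hφ hP hP' (m := p) (r := r) (hpos s)
      (κ := fun _ y => (∏ i, y i) ^ s)
      (fun x y _ hy => pow_ne_zero _ (Finset.prod_ne_zero_iff.2 fun i _ => hy i)) fun g h => ?_]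
    · push_cast; omega
    have hcond (α β : Fin 3 → ℕ) :
        (∀ i, (α i : ℤ) - β i + lam 1 = 0) ↔ ∀ i, β i = α i + s :=
      forall_congr' fun i => by omega
    rw [hK]
    simp only [hcond]
    rw [GLRep.sum_piAntidiag_shift, Finset.prod_mul_distrib, mul_pow]
    simp only [mul_mul_mul_comm (g.val 0 _)]
    ring
  · intro hb
    obtain ⟨s, hs⟩ := Int.eq_ofNat_of_zero_le (show 0 ≤ -lam 1 by omega)
    obtain rfl : p = q + 3 * s := by omega
    rw [GLRep.finrank_zeroWeightSpace hirr hv hφ hP hP' (m := q) (r := r) (hpos s)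
      (κ := fun x _ => (∏ i, x i) ^ s)
      (fun x y hx _ => pow_ne_zero _ (Finset.prod_ne_zero_iff.2 fun i _ => hx i)) fun g h => ?_]
    · push_cast; omega
    have hcond (α β : Fin 3 → ℕ) :
        (∀ i, (α i : ℤ) - β i + lam 1 = 0) ↔ ∀ i, α i = β i + s :=
      forall_congr' fun i => by omega
    -- Now `m = q`: the row and cross product factors exchange roles, and `β` is the free exponent.
    rw [hK, Finset.sum_comm]
    simp only [hcond]
    simp only [mul_comm ((Nat.multinomial Finset.univ _ : ℂ) *
      ∏ i, (g.val 0 i * h.val i 0) ^ _)]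
    rw [GLRep.sum_piAntidiag_shift, Finset.prod_mul_distrib, mul_pow]
    have hcomm (i : Fin 3) : GLRep.rowCross g.val i * GLRep.rowCross h.valᵀ i *
        (g.val 0 i * h.val i 0) =
        g.val 0 i * GLRep.rowCross g.val i * (h.val i 0 * GLRep.rowCross h.valᵀ i) := by ring
    simp only [hcomm, transpose_apply]
    ring
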